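/- Let $n,m\in\mathbb N$ and $q\in\mathbb R_{>0}$, and write $[k]=\{1,\dots,k\}$. A request sequence with $n$ offline nodes, $m$ online nodes and total quantity $q$ is $E=((N_t,q_t))_{t\in[m]}$ with non-empty sets $N_t\subseteq[n]$ and reals $q_t>0$ such that $\sum_t q_t=q$; $\mathcal E_{n,m,q}$ is the set of these sequences, and $\mathcal E^{\mathrm{nest}}_{n,m,q}$ the subset of the nested ones, i.e. those with $N_1\supseteq\dots\supseteq N_m$. Let $\Delta(N_t,q_t)$ be the set of $x\in\mathbb R_{\ge0}^n$ with $x(i)=0$ for $i\notin N_t$ and $\sum_i x(i)=q_t$, and let $\Delta(E)=\sum_t\Delta(N_t,q_t)$ (Minkowski sum) be the set of feasible load vectors. For $x,y\in\mathbb R_{\ge0}^n$, write $y\preceq x$ ($x$ majorizes $y$) if $\sum_i x(i)=\sum_i y(i)$ and, for every $j\in[n]$, the sum of the $j$ largest entries of $x$ is at least the sum of the $j$ largest entries of $y$. Let $\mathrm{OPT}(E)$ be the unique $\ell^*\in\Delta(E)$ with $\ell^*\preceq\ell$ for all $\ell\in\Delta(E)$. A policy $\mathcal A$ maps the history of past arrivals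 and past decisions, together with the current node $(N_t,q_t)$, to an allocation $x_t\in\Delta(N_t,q_t)$; it may be randomized, i.e. depend on random coin flips (the $x_t$ are then random variables). Its load vector on $E$ is $\mathcal A(E)=\sum_{t=1}^m x_t$. The water-filling policy chooses as $x_t$ the unique maximizer of $\min_{i\in N_t}\{x(i)+\ell_{t-1}(i)\}$ over $x\in\Delta(N_t,q_t)$, where $\ell_{t-1}=\sum_{s<t}x_s$; its load vector on $E$ is $\mathrm{WF}(E)$. **Theorem.** For every (possibly randomized) policy $\mathcal A$ and every $E\in\mathcal E_{n,m,q}$ there is a nested sequence $E'\in\mathcal E^{\mathrm{nest}}_{n,m,q}$ such that $$\mathrm{WF}(E)\preceq\mathbb E[\mathcal A(E')]\qquad\text{and}\qquad \mathrm{OPT}(E')\preceq\mathrm{OPT}(E),$$ where the expectation is over the randomness of $\mathcal A$. -/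

import Mathlib

open MeasureTheory

namespace OnlineAlloc

/-! ### Majorization -/

/-- The decreasing rearrangement of `x`: its `i`-th entry is the `i`-th largest entry of `x`. -/
noncomputable def decreasing {n : ℕ} (x : Fin n → ℝ) (i : Fin n) : ℝ := x (Tuple.sort x i.rev)

/-- `Majorizes x y` (`x ≽ y`): `x` and `y` have the same total, and for every `j` the sum of the
`j` largest entries of `x` is at least the sum of the `j` largest entries of `y`. -/
def Majorizes {n : ℕ} (x y : Fin n → ℝ) : Prop :=
  ∑ i, x i = ∑ i, y i ∧
    ∀ j : Fin n, ∑ i ∈ Finset.Iic j, decreasing y i ≤ ∑ i ∈ Finset.Iic j, decreasing x i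

/-! ### Requests, request sequences, feasible allocations -/

/-- An online node over `n` offline nodes: a nonempty set of neighbours and a positive quantity. -/
structure Request (n : ℕ) where
  nbhd : Finset (Fin n)
  nonempty : nbhd.Nonempty
  qty : ℝ
  qty_pos : 0 < qty

/-- The feasible allocations of a single online node. -/
def Request.feasible {n : ℕ} (r : Request n) : Set (Fin n → ℝ) :=
  {x | (∀ i, 0 ≤ x i) ∧ (∀ i, i ∉ r.nbhd → x i = 0) ∧ ∑ i, x i = r.qty}

/-- The request sequences with `n` offline nodes, `m` online nodes and total quantity `q`. -/
def requestSeqs (n m : ℕ) (q : ℝ) : Set (Fin m → Request n) :=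
  {E | ∑ t, (E t).qty = q}

/-- The nested ones among them: the neighbourhoods form a decreasing chain. -/
def nestedSeqs (n m : ℕ) (q : ℝ) : Set (Fin m → Request n) :=
  {E | E ∈ requestSeqs n m q ∧ ∀ s t : Fin m, s ≤ t → (E t).nbhd ⊆ (E s).nbhd}

/-- The feasible load vectors of a request sequence (the Minkowski sum of the feasible sets of its
online nodes). -/
def feasibleLoads {n m : ℕ} (E : Fin m → Request n) : Set (Fin n → ℝ) :=
  {ℓ | ∃ x : Fin m → Fin n → ℝ, (∀ t, x t ∈ (E t).feasible) ∧ ∑ t, x t = ℓ}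

/-! ### Policies -/

/-- A history: the past arrivals, each with the allocation that was chosen for it. -/
abbrev History (n : ℕ) := List (Request n × (Fin n → ℝ))

/-- The load vector accumulated along a history. -/
def History.load {n : ℕ} (h : History n) : Fin n → ℝ := (h.map Prod.snd).sum

/-- A deterministic online policy: it maps the history and the current online node to a feasible
allocation of that node. -/
structure Policy (n : ℕ) where
  act : History n → Request n → Fin n → ℝ
  act_mem : ∀ h r, act h r ∈ r.feasible

/-- The history generated by a policy on the first `k` arrivals of `E`. -/
def Policy.history {n m : ℕ} (A : Policy n) (E : Fin m → Request n) : ℕ → History n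
  | 0 => []
  | k + 1 =>
    if hk : k < m then
      A.history E k ++ [(E ⟨k, hk⟩, A.act (A.history E k) (E ⟨k, hk⟩))]
    else A.history E k

/-- The allocation chosen by a policy for the online node `t` of `E`. -/
def Policy.alloc {n m : ℕ} (A : Policy n) (E : Fin m → Request n) (t : Fin m) : Fin n → ℝ :=
  A.act (A.history E t) (E t)

/-- The final load vector `A(E)` of a policy on `E`. -/
def Policy.run {n m : ℕ} (A : Policy n) (E : Fin m → Request n) : Fin n → ℝ :=
  ∑ t, A.alloc E t

/-- The coordinatewise expectation `𝔼[A(E)]`, for a policy drawn at random: the coin flips are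
`ω`, distributed as `P`, and `A ω` is the deterministic policy that they determine. -/
noncomputable def expectedRun {n m : ℕ} {Ω : Type*} [MeasurableSpace Ω] (P : Measure Ω)
    (A : Ω → Policy n) (E : Fin m → Request n) : Fin n → ℝ :=
  fun i => ∫ ω, (A ω).run E i ∂P

/-! ### Water-filling -/

theorem Request.isCompact_feasible {n : ℕ} (r : Request n) : IsCompact r.feasible := by
  have hsub : r.feasible ⊆ Set.Icc (fun _ => 0) (fun _ => r.qty) := by
    rintro x ⟨h0, _, h2⟩
    refine ⟨h0, fun i => ?_⟩
    rw [← h2]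
    exact Finset.single_le_sum (fun j _ => h0 j) (Finset.mem_univ i)
  refine isCompact_Icc.of_isClosed_subset ?_ hsub
  have h1 : IsClosed {x : Fin n → ℝ | ∀ i, 0 ≤ x i} := by
    simp only [Set.ofPred_forall]
    exact isClosed_iInter fun i => isClosed_le continuous_const (continuous_apply i)
  have h2 : IsClosed {x : Fin n → ℝ | ∀ i, i ∉ r.nbhd → x i = 0} := by
    simp only [Set.ofPred_forall]
    exact isClosed_iInter fun i => isClosed_iInter fun _ =>
      isClosed_eq (continuous_apply i) continuous_const
  have h3 : IsClosed {x : Fin n → ℝ | ∑ i, x i = r.qty} :=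
    isClosed_eq (by fun_prop) continuous_const
  exact h1.inter (h2.inter h3)

theorem Request.feasible_nonempty {n : ℕ} (r : Request n) : r.feasible.Nonempty := by
  obtain ⟨i₀, hi₀⟩ := r.nonempty
  refine ⟨Pi.single i₀ r.qty, fun i => ?_, fun i hi => ?_, ?_⟩
  · by_cases h : i = i₀
    · subst h; simpa using r.qty_pos.le
    · simp [h]
  · have h : i ≠ i₀ := by rintro rfl; exact hi hi₀
    simp [h]
  · simp

/-- The objective of the water-filling program: the smallest load among the neighbours of `r`
after the allocation `x` has been added to the current load vector `ℓ`. -/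
noncomputable def minLoad {n : ℕ} (r : Request n) (ℓ x : Fin n → ℝ) : ℝ :=
  r.nbhd.inf' r.nonempty fun i => x i + ℓ i

/-- The water-filling program has exactly one solution. -/
theorem existsUnique_waterFill {n : ℕ} (r : Request n) (ℓ : Fin n → ℝ) :
    ∃! x, x ∈ r.feasible ∧ ∀ y ∈ r.feasible, minLoad r ℓ y ≤ minLoad r ℓ x := by
  have hcont : ContinuousOn (minLoad r ℓ) r.feasible := by
    apply Continuous.continuousOn
    unfold minLoad
    apply Continuous.finset_inf'_apply
    intro i _
    fun_prop
  obtain ⟨x, hx, hmax⟩ := r.isCompact_feasible.exists_isMaxOn r.feasible_nonempty hcont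
  have hmax' : ∀ y ∈ r.feasible, minLoad r ℓ y ≤ minLoad r ℓ x := fun y hy => hmax hy
  refine ⟨x, ⟨hx, hmax'⟩, ?_⟩
  rintro y ⟨hy, hymax⟩
  by_contra hne
  -- the minimum of two distinct solutions leaves some quantity over, which can be spread evenly
  have hval : minLoad r ℓ y = minLoad r ℓ x := le_antisymm (hmax' y hy) (hymax x hx)
  set v := minLoad r ℓ x with hv
  have hxv : ∀ i ∈ r.nbhd, v ≤ x i + ℓ i := fun i hi => Finset.inf'_le _ hi
  have hyv : ∀ i ∈ r.nbhd, v ≤ y i + ℓ i := fun i hi => by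
    rw [← hval]; exact Finset.inf'_le _ hi
  let z : Fin n → ℝ := fun i => min (x i) (y i)
  have hzx : ∑ i, z i < r.qty := by
    have hle : ∑ i, z i ≤ ∑ i, x i := Finset.sum_le_sum fun i _ => min_le_left _ _
    have hle' : ∑ i, z i ≤ ∑ i, y i := Finset.sum_le_sum fun i _ => min_le_right _ _
    rw [hx.2.2] at hle
    refine lt_of_le_of_ne hle fun heq => hne ?_
    have e1 : ∀ i, z i = x i := fun i =>
      (Finset.sum_eq_sum_iff_of_le (fun i _ => min_le_left (x i) (y i))).1
        (heq.trans hx.2.2.symm) i (Finset.mem_univ i)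
    have e2 : ∀ i, z i = y i := fun i =>
      (Finset.sum_eq_sum_iff_of_le (fun i _ => min_le_right (x i) (y i))).1
        (heq.trans hy.2.2.symm) i (Finset.mem_univ i)
    funext i
    rw [← e2, e1]
  have hcard : (0 : ℝ) < r.nbhd.card := by exact_mod_cast r.nonempty.card_pos
  let δ : ℝ := (r.qty - ∑ i, z i) / r.nbhd.card
  have hδ : 0 < δ := div_pos (by linarith) hcard
  let w : Fin n → ℝ := fun i => z i + if i ∈ r.nbhd then δ else 0
  have hw : w ∈ r.feasible := by
    refine ⟨fun i => ?_, fun i hi => ?_, ?_⟩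
    · have : 0 ≤ z i := le_min (hx.1 i) (hy.1 i)
      simp only [w]; split_ifs <;> linarith
    · simp [w, z, hi, hx.2.1 i hi, hy.2.1 i hi]
    · simp only [w, Finset.sum_add_distrib, Finset.sum_ite_mem, Finset.univ_inter,
        Finset.sum_const, nsmul_eq_mul, δ]
      field_simp
      ring
  have hlt : v < minLoad r ℓ w := by
    refine (Finset.lt_inf'_iff _).2 fun i hi => ?_
    have : v ≤ z i + ℓ i := by
      rcases min_choice (x i) (y i) with h | h
      · simp only [z, h]; exact hxv i hi
      · simp only [z, h]; exact hyv i hi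
    simp only [w, hi, if_true]
    linarith
  exact absurd (hmax' w hw) (not_le.2 hlt)

/-- The water-filling allocation of `r` at the current load vector `ℓ`: the feasible allocation
that maximizes the smallest resulting load among the neighbours. -/
noncomputable def waterFill {n : ℕ} (r : Request n) (ℓ : Fin n → ℝ) : Fin n → ℝ :=
  (existsUnique_waterFill r ℓ).choose

/-- The water-filling policy. -/
noncomputable def WF (n : ℕ) : Policy n where
  act h r := waterFill r h.load
  act_mem h r := (existsUnique_waterFill r h.load).choose_spec.1.1

/-! ### The hindsight optimum -/

/-- `ℓ` is a feasible load vector of `E` that is majorized by every feasible load vector. -/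
def IsMajorizationMinimal {n m : ℕ} (E : Fin m → Request n) (ℓ : Fin n → ℝ) : Prop :=
  ℓ ∈ feasibleLoads E ∧ ∀ ℓ' ∈ feasibleLoads E, Majorizes ℓ' ℓ

theorem decreasing_antitone {n : ℕ} (x : Fin n → ℝ) : Antitone (decreasing x) :=
  fun _ _ h => Tuple.monotone_sort x (Fin.rev_le_rev.2 h)

/-- The indices of the `j + 1` largest entries. -/
noncomputable def topSet {n : ℕ} (x : Fin n → ℝ) (j : Fin n) : Finset (Fin n) :=
  (Finset.Iic j).map (Fin.revPerm.trans (Tuple.sort x)).toEmbedding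

theorem sum_topSet {n : ℕ} (x y : Fin n → ℝ) (j : Fin n) :
    ∑ i ∈ topSet x j, y i = ∑ i ∈ Finset.Iic j, y (Tuple.sort x i.rev) := by
  simp [topSet]

theorem card_topSet {n : ℕ} (x : Fin n → ℝ) (j : Fin n) :
    (topSet x j).card = (Finset.Iic j).card := by
  simp [topSet]

/-- The sum of the largest entries in terms of a threshold. -/
theorem sum_decreasing_eq {n : ℕ} (x : Fin n → ℝ) (j : Fin n) :
    ∑ i ∈ Finset.Iic j, decreasing x i =
      (Finset.Iic j).card * decreasing x j + ∑ i, max (x i - decreasing x j) 0 := by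
  have h1 : ∑ i, max (x i - decreasing x j) 0 =
      ∑ i, max (decreasing x i - decreasing x j) 0 :=
    (Equiv.sum_comp (Fin.revPerm.trans (Tuple.sort x))
      (fun i => max (x i - decreasing x j) 0)).symm
  have h2 : ∑ i, max (decreasing x i - decreasing x j) 0 =
      ∑ i ∈ Finset.Iic j, (decreasing x i - decreasing x j) := by
    rw [← Finset.sum_subset (Finset.subset_univ (Finset.Iic j))]
    · refine Finset.sum_congr rfl fun i hi => max_eq_left ?_
      have := decreasing_antitone x (Finset.mem_Iic.1 hi)
      linarith
    · intro i _ hi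
      have hji : j ≤ i := le_of_lt (by simpa using hi)
      have := decreasing_antitone x hji
      exact max_eq_right (by linarith)
  rw [h1, h2, Finset.sum_sub_distrib, Finset.sum_const, nsmul_eq_mul]
  ring

theorem sum_le_threshold {n : ℕ} (x : Fin n → ℝ) (S : Finset (Fin n)) (γ : ℝ) :
    ∑ i ∈ S, x i ≤ S.card * γ + ∑ i, max (x i - γ) 0 := by
  have h1 : ∑ i ∈ S, (x i - γ) ≤ ∑ i ∈ S, max (x i - γ) 0 :=
    Finset.sum_le_sum fun i _ => le_max_left _ _
  have h2 : ∑ i ∈ S, max (x i - γ) 0 ≤ ∑ i, max (x i - γ) 0 :=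
    Finset.sum_le_sum_of_subset_of_nonneg (Finset.subset_univ S) fun i _ _ => le_max_right _ _
  rw [Finset.sum_sub_distrib, Finset.sum_const, nsmul_eq_mul] at h1
  linarith

theorem sum_le_sum_decreasing {n : ℕ} (x : Fin n → ℝ) (j : Fin n) (S : Finset (Fin n))
    (hS : S.card = (Finset.Iic j).card) :
    ∑ i ∈ S, x i ≤ ∑ i ∈ Finset.Iic j, decreasing x i := by
  rw [sum_decreasing_eq, ← hS]
  exact sum_le_threshold x S _

theorem isCompact_feasibleLoads {n m : ℕ} (E : Fin m → Request n) :
    IsCompact (feasibleLoads E) := by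
  have h : feasibleLoads E =
      (fun x : Fin m → Fin n → ℝ => ∑ t, x t) '' Set.univ.pi fun t => (E t).feasible := by
    ext ℓ
    simp [feasibleLoads]
  rw [h]
  exact (isCompact_univ_pi fun t => (E t).isCompact_feasible).image (by fun_prop)

theorem sum_feasibleLoads {n m : ℕ} {E : Fin m → Request n} {ℓ : Fin n → ℝ}
    (h : ℓ ∈ feasibleLoads E) : ∑ i, ℓ i = ∑ t, (E t).qty := by
  obtain ⟨x, hx, rfl⟩ := h
  simp only [Finset.sum_apply]
  rw [Finset.sum_comm]
  exact Finset.sum_congr rfl fun t _ => (hx t).2.2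

theorem exists_isMajorizationMinimal {n m : ℕ} (E : Fin m → Request n) :
    ∃ ℓ, IsMajorizationMinimal E ℓ := by
  have hne : (feasibleLoads E).Nonempty :=
    ⟨_, fun t => (E t).feasible_nonempty.some, fun t => (E t).feasible_nonempty.some_mem, rfl⟩
  obtain ⟨ℓ, hℓ, hmin⟩ := (isCompact_feasibleLoads E).exists_isMinOn hne
    (f := fun ℓ => ∑ i, ℓ i ^ 2) (by fun_prop)
  have hmin' : ∀ y ∈ feasibleLoads E, ∑ i, ℓ i ^ 2 ≤ ∑ i, y i ^ 2 := fun y hy => hmin hy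
  obtain ⟨x, hx, hxl⟩ := id hℓ
  -- no mass can be moved to a less loaded neighbour
  have key : ∀ t i j, 0 < x t i → j ∈ (E t).nbhd → ℓ i ≤ ℓ j := by
    intro t i j hti hj
    by_contra! hlt
    have hij : i ≠ j := by rintro rfl; exact lt_irrefl _ hlt
    obtain ⟨ε, hε, hε1, hε2⟩ : ∃ ε : ℝ, 0 < ε ∧ ε ≤ x t i ∧ ε < ℓ i - ℓ j :=
      ⟨min (x t i) ((ℓ i - ℓ j) / 2), lt_min hti (by linarith), min_le_left _ _,
        lt_of_le_of_lt (min_le_right _ _) (by linarith)⟩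
    have hi : i ∈ (E t).nbhd := by
      by_contra h
      exact hti.ne' ((hx t).2.1 i h)
    let d : Fin n → ℝ := Pi.single j ε - Pi.single i ε
    have hdi : d i = -ε := by simp [d, hij]
    have hdj : d j = ε := by simp [d, hij.symm]
    have hdo : ∀ k, k ≠ i → k ≠ j → d k = 0 := fun k h1 h2 => by simp [d, h1, h2]
    have hmem : ℓ + d ∈ feasibleLoads E := by
      refine ⟨x + Pi.single t d, fun s => ?_, ?_⟩
      · by_cases hs : s = t
        · subst hs
          refine ⟨fun k => ?_, fun k hk => ?_, ?_⟩
          · simp only [Pi.add_apply, Pi.single_eq_same]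
            have h0 := (hx s).1 k
            by_cases h1 : k = i
            · subst h1; rw [hdi]; linarith
            · by_cases h2 : k = j
              · subst h2; rw [hdj]; linarith
              · rw [hdo k h1 h2]; linarith
          · have h1 : k ≠ i := by rintro rfl; exact hk hi
            have h2 : k ≠ j := by rintro rfl; exact hk hj
            simp [hdo k h1 h2, (hx s).2.1 k hk]
          · simp [d, Finset.sum_add_distrib, (hx s).2.2]
        · simpa [hs] using hx s
      · simp only [Pi.add_apply, Finset.sum_add_distrib, hxl]
        simp
    have h := hmin' _ hmem
    have hexp : ∑ k, (ℓ + d) k ^ 2 = ∑ k, ℓ k ^ 2 + ∑ k, (2 * ℓ k * d k + d k ^ 2) := by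
      rw [← Finset.sum_add_distrib]
      exact Finset.sum_congr rfl fun k _ => by simp only [Pi.add_apply]; ring
    have hsum : ∑ k, (2 * ℓ k * d k + d k ^ 2) =
        (2 * ℓ i * d i + d i ^ 2) + (2 * ℓ j * d j + d j ^ 2) :=
      Fintype.sum_eq_add i j hij fun k hk => by simp [hdo k hk.1 hk.2]
    rw [hexp, hsum, hdi, hdj] at h
    nlinarith
  refine ⟨ℓ, hℓ, fun y hy => ⟨by rw [sum_feasibleLoads hy, sum_feasibleLoads hℓ], fun j => ?_⟩⟩
  set γ := decreasing y j with hγ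
  have hthr : ∑ i, max (ℓ i - γ) 0 ≤ ∑ i, max (y i - γ) 0 := by
    let W : Finset (Fin n) := Finset.univ.filter fun i => γ < ℓ i
    have hW : ∑ i ∈ W, ℓ i ≤ ∑ i ∈ W, y i := by
      obtain ⟨x', hx', rfl⟩ := hy
      rw [← hxl]
      simp only [Finset.sum_apply]
      rw [Finset.sum_comm, Finset.sum_comm (s := W)]
      refine Finset.sum_le_sum fun t _ => ?_
      by_cases h : ∃ i ∈ W, 0 < x t i
      · obtain ⟨i, hiW, hi⟩ := h
        have hsub : ∀ k, k ∉ W → x' t k = 0 := fun k hk => (hx' t).2.1 k fun hkN => hk <| by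
          have h1 := key t i k hi hkN
          have h2 : γ < ℓ i := by simpa [W] using hiW
          simpa [W] using h2.trans_le h1
        calc ∑ i ∈ W, x t i ≤ ∑ i, x t i :=
              Finset.sum_le_sum_of_subset_of_nonneg (Finset.subset_univ W) fun i _ _ => (hx t).1 i
          _ = ∑ i, x' t i := by rw [(hx t).2.2, (hx' t).2.2]
          _ = ∑ i ∈ W, x' t i :=
              (Finset.sum_subset (Finset.subset_univ W) fun k _ hk => hsub k hk).symm
      · push Not at h
        exact Finset.sum_le_sum fun i hi => (h i hi).trans ((hx' t).1 i)
    have hL : ∑ i, max (ℓ i - γ) 0 = ∑ i ∈ W, ℓ i - W.card * γ := by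
      rw [← Finset.sum_subset (Finset.subset_univ W)]
      · rw [← nsmul_eq_mul, ← Finset.sum_const, ← Finset.sum_sub_distrib]
        refine Finset.sum_congr rfl fun i hi => max_eq_left ?_
        have : γ < ℓ i := by simpa [W] using hi
        linarith
      · intro i _ hi
        have : ℓ i ≤ γ := by simpa [W] using hi
        exact max_eq_right (by linarith)
    have := sum_le_threshold y W γ
    linarith
  calc ∑ i ∈ Finset.Iic j, decreasing ℓ i = ∑ i ∈ topSet ℓ j, ℓ i := (sum_topSet ℓ ℓ j).symm
    _ ≤ (topSet ℓ j).card * γ + ∑ i, max (ℓ i - γ) 0 := sum_le_threshold _ _ _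
    _ ≤ (Finset.Iic j).card * γ + ∑ i, max (y i - γ) 0 := by rw [card_topSet]; linarith
    _ = ∑ i ∈ Finset.Iic j, decreasing y i := (sum_decreasing_eq y j).symm

theorem isMajorizationMinimal_unique {n m : ℕ} {E : Fin m → Request n} {a b : Fin n → ℝ}
    (ha : IsMajorizationMinimal E a) (hb : IsMajorizationMinimal E b) : a = b := by
  let z : Fin n → ℝ := fun i => (a i + b i) / 2
  have hz : z ∈ feasibleLoads E := by
    obtain ⟨⟨x, hx, hxa⟩, -⟩ := ha
    obtain ⟨⟨y, hy, hyb⟩, -⟩ := hb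
    refine ⟨fun t i => (x t i + y t i) / 2, fun t => ⟨fun i => ?_, fun i hi => ?_, ?_⟩, ?_⟩
    · have := (hx t).1 i
      have := (hy t).1 i
      positivity
    · simp [(hx t).2.1 i hi, (hy t).2.1 i hi]
    · rw [← Finset.sum_div, Finset.sum_add_distrib, (hx t).2.2, (hy t).2.2]
      ring
    · funext i
      simp only [z, ← hxa, ← hyb, Finset.sum_apply]
      rw [← Finset.sum_div, Finset.sum_add_distrib]
  have hab : ∀ j, ∑ i ∈ topSet z j, a i = ∑ i ∈ topSet z j, b i := by
    intro j
    have h1 := (ha.2 z hz).2 j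
    have h2 := (hb.2 z hz).2 j
    have h3 := sum_le_sum_decreasing a j (topSet z j) (card_topSet z j)
    have h4 := sum_le_sum_decreasing b j (topSet z j) (card_topSet z j)
    have h5 : ∑ i ∈ Finset.Iic j, decreasing z i =
        (∑ i ∈ topSet z j, a i + ∑ i ∈ topSet z j, b i) / 2 := by
      rw [← Finset.sum_add_distrib, Finset.sum_div]
      exact (sum_topSet z z j).symm
    have h6 := (ha.2 b hb.1).2 j
    have h7 := (hb.2 a ha.1).2 j
    linarith
  have hpt : ∀ j : Fin n, a (Tuple.sort z j.rev) = b (Tuple.sort z j.rev) := by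
    intro j
    induction j using WellFoundedLT.induction with
    | ind j ih =>
      have h := hab j
      rw [sum_topSet, sum_topSet, ← Finset.Iio_insert, Finset.sum_insert (by simp),
        Finset.sum_insert (by simp),
        Finset.sum_congr rfl fun i hi => ih i (Finset.mem_Iio.1 hi)] at h
      linarith
  funext i
  simpa using hpt ((Tuple.sort z).symm i).rev

theorem existsUnique_OPT {n m : ℕ} (E : Fin m → Request n) :
    ∃! ℓ, IsMajorizationMinimal E ℓ := by
  obtain ⟨ℓ, hℓ⟩ := exists_isMajorizationMinimal E
  exact ⟨ℓ, hℓ, fun y hy => isMajorizationMinimal_unique hy hℓ⟩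

/-- The hindsight optimum: the unique feasible load vector that is majorized by every feasible
load vector. -/
noncomputable def OPT {n m : ℕ} (E : Fin m → Request n) : Fin n → ℝ :=
  (existsUnique_OPT E).choose

end OnlineAlloc

open OnlineAlloc

namespace OnlineAlloc

/-! ### Histories and causality -/

/-! Both load vectors are compared with one benchmark. Let `w` be the final load of water-filling on
`E`, let `λ_t` be the water level of the node `t`, and let `k_t` be the number of offline nodes with
final load at least `λ_t`. For each `j` the benchmark is the sum over `t` of `q_t * share j k_t`,
where `share j k = min(1, j/k)` for `k > 0`: the total of `j` nodes that lie latest in a nested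
chain of sets of sizes `k_t`, when every quantity is split evenly.

Water-filling stays below it (`sum_run_WF_le`). At height `v`, a set of `j` nodes meets the region
under `w` in at most `k(v) * share j k(v)` nodes, where `k(v)` counts the nodes with `w i ≥ v`. As
`k` decreases in `v`, this share grows with `v`. The mass placed by `t` lies below `λ_t`, so it is
charged at most `share j k_t` per unit.

Any policy can be forced above it (`exists_adversary`, `exists_sum_ge_share`). The adversary keeps
the quantities and sizes of `nestedHull E`, but always passes on to the nodes of the current set
with the largest expected load. This never lowers the average load of the current set, so some `j`
nodes get at least the benchmark. Since only expectations are used, the sequence does not depend on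
the coin flips.

The optimum does not get worse. Every neighbour of `t` ends with load at least `λ_t`, so `nestedHull
E` only reorders the arrivals and enlarges neighbourhoods. The adversary's chain has the same
cardinalities, hence is a relabelling of it (`exists_perm_of_card_eq`), and `majorizes_OPT` applies.
-/

theorem Policy.history_congr {n m : ℕ} (A : Policy n) {E F : Fin m → Request n} {k : ℕ}
    (h : ∀ s : Fin m, (s : ℕ) < k → E s = F s) : A.history E k = A.history F k := by
  induction k with
  | zero => rfl
  | succ k ih =>
    have ih' := ih fun s hs => h s (by omega)
    by_cases hk : k < m
    · simp only [Policy.history, hk, dite_true, ih', h ⟨k, hk⟩ (Nat.lt_succ_self k)]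
    · simp only [Policy.history, hk, dite_false, ih']

/-- Policies are causal: a decision depends only on the arrivals so far. -/
theorem Policy.alloc_congr {n m : ℕ} (A : Policy n) {E F : Fin m → Request n} {t : Fin m}
    (h : ∀ s ≤ t, E s = F s) : A.alloc E t = A.alloc F t := by
  unfold Policy.alloc
  rw [A.history_congr (F := F) fun s hs => h s (Fin.le_def.2 hs.le), h t le_rfl]

theorem Policy.alloc_mem {n m : ℕ} (A : Policy n) (E : Fin m → Request n) (t : Fin m) :
    A.alloc E t ∈ (E t).feasible :=
  A.act_mem _ _

theorem Policy.load_history_succ {n m : ℕ} (A : Policy n) (E : Fin m → Request n) (t : Fin m) :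
    History.load (A.history E (t + 1)) = History.load (A.history E t) + A.alloc E t := by
  simp [Policy.history, Policy.alloc, History.load]

theorem Policy.load_history {n m : ℕ} (A : Policy n) (E : Fin m → Request n) :
    History.load (A.history E m) = A.run E := by
  have h : ∀ k ≤ m, History.load (A.history E k) =
      ∑ s ∈ Finset.range k, if hs : s < m then A.alloc E ⟨s, hs⟩ else 0 := by
    intro k hk
    induction k with
    | zero => simp [Policy.history, History.load]
    | succ k ih =>
      have hkm : k < m := hk
      rw [Finset.sum_range_succ, ← ih hkm.le, dif_pos hkm]
      exact A.load_history_succ E ⟨k, hkm⟩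
  rw [h m le_rfl, Finset.sum_range, Policy.run]
  exact Finset.sum_congr rfl fun t _ => by simp

theorem Policy.load_history_mono {n m : ℕ} (A : Policy n) (E : Fin m → Request n) (i : Fin n) :
    Monotone fun k => History.load (A.history E k) i := by
  refine monotone_nat_of_le_succ fun k => ?_
  by_cases hk : k < m
  · have := A.load_history_succ E ⟨k, hk⟩
    simp only at this
    rw [this, Pi.add_apply]
    have := (A.alloc_mem E ⟨k, hk⟩).1 i
    linarith
  · simp [Policy.history, hk]

theorem Policy.sum_run {n m : ℕ} (A : Policy n) (E : Fin m → Request n) :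
    ∑ i, A.run E i = ∑ t, (E t).qty :=
  sum_feasibleLoads ⟨A.alloc E, A.alloc_mem E, rfl⟩

/-! ### Water levels -/

theorem waterFill_mem {n : ℕ} (r : Request n) (ℓ : Fin n → ℝ) : waterFill r ℓ ∈ r.feasible :=
  (existsUnique_waterFill r ℓ).choose_spec.1.1

theorem minLoad_le_waterFill {n : ℕ} (r : Request n) (ℓ y : Fin n → ℝ) (hy : y ∈ r.feasible) :
    minLoad r ℓ y ≤ minLoad r ℓ (waterFill r ℓ) :=
  (existsUnique_waterFill r ℓ).choose_spec.1.2 y hy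

/-- Water-filling raises no node above the water level. -/
theorem add_le_minLoad_waterFill {n : ℕ} (r : Request n) (ℓ : Fin n → ℝ) (i : Fin n)
    (hi : 0 < waterFill r ℓ i) :
    waterFill r ℓ i + ℓ i ≤ minLoad r ℓ (waterFill r ℓ) := by
  have hx := waterFill_mem r ℓ
  have hopt := minLoad_le_waterFill r ℓ
  set x := waterFill r ℓ
  set v := minLoad r ℓ x with hv
  by_contra! hlt
  have hiN : i ∈ r.nbhd := by
    by_contra h
    exact hi.ne' (hx.2.1 i h)
  obtain ⟨ε, hε, hε1, hε2⟩ : ∃ ε : ℝ, 0 < ε ∧ ε ≤ x i ∧ ε ≤ x i + ℓ i - v :=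
    ⟨min (x i) (x i + ℓ i - v), lt_min hi (by linarith), min_le_left _ _, min_le_right _ _⟩
  have hcard : (0 : ℝ) < r.nbhd.card := by exact_mod_cast r.nonempty.card_pos
  have hδ : 0 < ε / r.nbhd.card := div_pos hε hcard
  -- Take `ε` off the overfull node and spread it evenly over the neighbourhood. By the choice of
  -- `ε`, node `i` does not drop below `v` before the spreading, so afterwards every neighbour is
  -- strictly above `v`.
  let z : Fin n → ℝ := fun k =>
    x k - (if k = i then ε else 0) + if k ∈ r.nbhd then ε / r.nbhd.card else 0
  have hz : z ∈ r.feasible := by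
    refine ⟨fun k => ?_, fun k hk => ?_, ?_⟩
    · have := hx.1 k
      by_cases h : k = i
      · subst h; simp only [z, hiN, if_true]; linarith
      · simp only [z, h, if_false]; split_ifs <;> linarith
    · have h : k ≠ i := by rintro rfl; exact hk hiN
      simp [z, h, hk, hx.2.1 k hk]
    · simp only [z, Finset.sum_add_distrib, Finset.sum_sub_distrib, hx.2.2, Finset.sum_ite_mem,
        Finset.univ_inter, Finset.sum_const, nsmul_eq_mul, Finset.sum_ite_eq', Finset.mem_univ,
        if_true]
      field_simp
      ring
  refine absurd (hopt z hz) (not_le.2 ((Finset.lt_inf'_iff _).2 fun k hk => ?_))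
  have hvk : v ≤ x k + ℓ k := Finset.inf'_le _ hk
  by_cases h : k = i
  · subst h; simp only [z, hk, if_true]; linarith
  · simp only [z, h, hk, if_true, if_false]; linarith

/-- The water level of the online node `t` when water-filling runs on `E`. -/
noncomputable def waterLevel {n m : ℕ} (E : Fin m → Request n) (t : Fin m) : ℝ :=
  minLoad (E t) (History.load ((WF n).history E t)) ((WF n).alloc E t)

/-- Loads never decrease, so the level reached at time `t` persists to the end. -/
theorem waterLevel_le_run {n m : ℕ} (E : Fin m → Request n) (t : Fin m) (i : Fin n)
    (hi : i ∈ (E t).nbhd) : waterLevel E t ≤ (WF n).run E i := by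
  have h1 : waterLevel E t ≤ (WF n).alloc E t i + History.load ((WF n).history E t) i :=
    Finset.inf'_le _ hi
  have h2 := (WF n).load_history_mono E i (Nat.succ_le_of_lt t.2)
  simp only [Nat.succ_eq_add_one] at h2
  rw [(WF n).load_history_succ E t, (WF n).load_history, Pi.add_apply] at h2
  linarith

theorem load_le_waterLevel {n m : ℕ} (E : Fin m → Request n) (t : Fin m) (i : Fin n)
    (hi : 0 < (WF n).alloc E t i) :
    History.load ((WF n).history E (t + 1)) i ≤ waterLevel E t := by
  rw [(WF n).load_history_succ E t, Pi.add_apply, add_comm]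
  exact add_le_minLoad_waterFill _ _ i hi

/-- The mass that water-filling places on node `i` lies at heights between `0` and the final
load of `i`, and the mass coming from `t` lies below the water level of `t`. -/
theorem integral_le_sum_alloc_mul {n m : ℕ} (E : Fin m → Request n) {g : ℝ → ℝ}
    (hg : Monotone g) (i : Fin n) :
    ∫ v in (0 : ℝ)..(WF n).run E i, g v ≤ ∑ t, (WF n).alloc E t i * g (waterLevel E t) := by
  set ℓ : ℕ → ℝ := fun k => History.load ((WF n).history E k) i with hℓ
  have h0 : ℓ 0 = 0 := by simp [hℓ, Policy.history, History.load]
  have hm : ℓ m = (WF n).run E i := by simp only [hℓ, Policy.load_history]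
  -- Cut the interval from `0` to the final load at the successive loads of `i`; the piece of `t`
  -- has length `alloc E t i`.
  rw [← h0, ← hm, ← intervalIntegral.sum_integral_adjacent_intervals
    (fun k _ => hg.intervalIntegrable), Finset.sum_range]
  refine Finset.sum_le_sum fun t _ => ?_
  have hstep : ℓ (t + 1) = ℓ t + (WF n).alloc E t i := by
    simp only [hℓ, Policy.load_history_succ, Pi.add_apply]
  -- A node that receives nothing from `t` may already be above the water level, but then its piece
  -- is empty.
  rcases ((WF n).alloc_mem E t).1 i |>.eq_or_lt with h | h
  · rw [hstep, ← h]; simp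
  · have hle : ℓ t ≤ ℓ (t + 1) := by linarith
    have hlev : ℓ (t + 1) ≤ waterLevel E t := load_le_waterLevel E t i h
    calc ∫ v in ℓ t..ℓ (t + 1), g v ≤ ∫ _ in ℓ t..ℓ (t + 1), g (waterLevel E t) :=
          intervalIntegral.integral_mono_on hle hg.intervalIntegrable
            intervalIntegrable_const fun v hv => hg (hv.2.trans hlev)
      _ = (WF n).alloc E t i * g (waterLevel E t) := by
          rw [intervalIntegral.integral_const, hstep, smul_eq_mul]; ring

/-! ### Superlevel sets -/

/-- The nodes whose value is at least `v`. -/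
noncomputable def superlevel {n : ℕ} (w : Fin n → ℝ) (v : ℝ) : Finset (Fin n) :=
  Finset.univ.filter fun i => v ≤ w i

theorem mem_superlevel {n : ℕ} {w : Fin n → ℝ} {v : ℝ} {i : Fin n} :
    i ∈ superlevel w v ↔ v ≤ w i := by simp [superlevel]

theorem superlevel_anti {n : ℕ} (w : Fin n → ℝ) : Antitone (superlevel w) :=
  fun _ _ h _ hi => mem_superlevel.2 (h.trans (mem_superlevel.1 hi))

/-- The share of a set of `k` nodes that `j` of them can cover. -/
noncomputable def share (j k : ℕ) : ℝ := if k ≤ j then 1 else (j : ℝ) / k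

theorem share_le_one (j k : ℕ) : share j k ≤ 1 := by
  unfold share
  split_ifs with h
  · exact le_rfl
  · push Not at h
    exact div_le_one_of_le₀ (by exact_mod_cast h.le) (Nat.cast_nonneg k)

theorem share_le_div {j k : ℕ} (h : j ≤ k) (hk : 0 < k) : share j k ≤ (j : ℝ) / k := by
  unfold share
  split_ifs with h'
  · rw [le_antisymm h h', div_self (by positivity)]
  · exact le_rfl

/-- The convention `share j 0 = 1`, in place of `0` from division by zero, makes this hold at `0`.
It is needed because superlevel sets above the maximal load are empty. -/
theorem share_antitone (j : ℕ) : Antitone (share j) := by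
  intro a b hab
  by_cases ha : a ≤ j
  · calc share j b ≤ 1 := share_le_one j b
      _ = share j a := by simp [share, ha]
  · have hb : ¬ b ≤ j := by omega
    simp only [share, ha, hb, if_false]
    have : (0 : ℝ) < a := by exact_mod_cast (by omega : 0 < a)
    gcongr

theorem le_mul_share {s j k : ℕ} (hj : s ≤ j) (hk : s ≤ k) : (s : ℝ) ≤ k * share j k := by
  unfold share
  split_ifs with h
  · rw [mul_one]; exact_mod_cast hk
  · have : (k : ℝ) ≠ 0 := by exact_mod_cast (by omega : k ≠ 0)
    rw [mul_div_cancel₀ _ this]; exact_mod_cast hj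

/-- Layer-cake bound for the total of `w` on a set of `j` nodes. -/
theorem sum_le_sum_integral_share {n : ℕ} (w : Fin n → ℝ) (hw : ∀ i, 0 ≤ w i)
    (S : Finset (Fin n)) :
    ∑ i ∈ S, w i ≤
      ∑ i, ∫ v in (0 : ℝ)..w i, share S.card (superlevel w v).card := by
  set g : ℝ → ℝ := fun v => share S.card (superlevel w v).card with hgdef
  have hg : Monotone g := fun a b hab =>
    share_antitone _ (Finset.card_le_card (superlevel_anti w hab))
  -- A common upper bound for the loads, so that all integrals run over one interval and can be
  -- summed under the integral sign.
  set C : ℝ := ∑ i, w i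
  have hC : ∀ i, w i ≤ C := fun i => Finset.single_le_sum (fun j _ => hw j) (Finset.mem_univ i)
  have hcut : ∀ {f : ℝ → ℝ} i, ∫ v in (0 : ℝ)..w i, f v =
      ∫ v in Set.Ioc 0 C, (Set.Iic (w i)).indicator f v := by
    intro f i
    rw [intervalIntegral.integral_of_le (hw i), setIntegral_indicator measurableSet_Iic,
      Set.Ioc_inter_Iic, min_eq_right (hC i)]
  have hint : ∀ {f : ℝ → ℝ} i, Monotone f →
      IntegrableOn (fun v => (Set.Iic (w i)).indicator f v) (Set.Ioc 0 C) := by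
    intro f i hf
    refine IntegrableOn.integrable (Integrable.indicator ?_ measurableSet_Iic)
    exact (intervalIntegrable_iff_integrableOn_Ioc_of_le ((hw i).trans (hC i))).1
      hf.intervalIntegrable
  have hone : ∀ i, w i = ∫ v in Set.Ioc 0 C, (Set.Iic (w i)).indicator (fun _ => (1 : ℝ)) v := by
    intro i
    rw [← hcut i]; simp
  calc ∑ i ∈ S, w i
      = ∫ v in Set.Ioc 0 C, ∑ i ∈ S, (Set.Iic (w i)).indicator (fun _ => (1 : ℝ)) v := by
        rw [integral_finsetSum _ fun i _ => hint i monotone_const]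
        exact Finset.sum_congr rfl fun i _ => hone i
    _ ≤ ∫ v in Set.Ioc 0 C, ∑ i, (Set.Iic (w i)).indicator g v := by
        refine integral_mono (integrable_finsetSum _ fun i _ => hint i monotone_const)
          (integrable_finsetSum _ fun i _ => hint i hg) fun v => ?_
        have h1 : ∑ i ∈ S, (Set.Iic (w i)).indicator (fun _ => (1 : ℝ)) v =
            ((S.filter fun i => v ≤ w i).card : ℝ) := by
          simp [Set.indicator_apply]
        have h2 : ∑ i, (Set.Iic (w i)).indicator g v = (superlevel w v).card * g v := by
          simp [Set.indicator_apply, Finset.sum_ite, superlevel]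
        simp only [h1, h2]
        -- The slice of `S` at height `v` is bounded both by the size of `S` and by that of the
        -- whole superlevel set.
        exact le_mul_share (Finset.card_filter_le _ _)
          (Finset.card_le_card (Finset.filter_subset_filter _ (Finset.subset_univ S)))
    _ = ∑ i, ∫ v in (0 : ℝ)..w i, g v := by
        rw [integral_finsetSum _ fun i _ => hint i hg]
        exact Finset.sum_congr rfl fun i _ => (hcut i).symm

/-- The load of water-filling on a set of `j` nodes is at most what `j` nodes of the nested
instance with neighbourhoods `{i | waterLevel E t ≤ WF(E)(i)}` receive under even splitting. -/
theorem sum_run_WF_le {n m : ℕ} (E : Fin m → Request n) (S : Finset (Fin n)) :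
    ∑ i ∈ S, (WF n).run E i ≤
      ∑ t, (E t).qty * share S.card (superlevel ((WF n).run E) (waterLevel E t)).card := by
  set w := (WF n).run E with hw
  have hw0 : ∀ i, 0 ≤ w i := fun i => by
    rw [hw, Policy.run, Finset.sum_apply]
    exact Finset.sum_nonneg fun t _ => ((WF n).alloc_mem E t).1 i
  refine (sum_le_sum_integral_share w hw0 S).trans ?_
  have hg : Monotone fun v => share S.card (superlevel w v).card := fun a b hab =>
    share_antitone _ (Finset.card_le_card (superlevel_anti w hab))
  refine (Finset.sum_le_sum fun i _ => integral_le_sum_alloc_mul E hg i).trans ?_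
  rw [Finset.sum_comm]
  exact Finset.sum_le_sum fun t _ => by rw [← Finset.sum_mul, ((WF n).alloc_mem E t).2.2]

/-! ### Sets of largest entries -/

/-- `S` consists of the `S.card` largest entries of `a` on `N`. -/
def IsTop {α : Type*} (a : α → ℝ) (N S : Finset α) : Prop :=
  S ⊆ N ∧ ∀ i ∈ S, ∀ j ∈ N, j ∉ S → a j ≤ a i

theorem exists_isTop {α : Type*} (a : α → ℝ) (N : Finset α) {k : ℕ}
    (hk : k ≤ N.card) : ∃ S, IsTop a N S ∧ S.card = k := by
  classical
  induction k with
  | zero => exact ⟨∅, ⟨Finset.empty_subset N, by simp⟩, rfl⟩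
  | succ k ih =>
    obtain ⟨S, ⟨hSN, htop⟩, hS⟩ := ih (by omega)
    have hne : (N \ S).Nonempty := by
      rw [← Finset.card_pos, Finset.card_sdiff_of_subset hSN]
      omega
    -- Greedy choice: the next element is a largest one among those left.
    obtain ⟨x, hx, hmax⟩ := Finset.exists_max_image (N \ S) a hne
    obtain ⟨hxN, hxS⟩ := Finset.mem_sdiff.1 hx
    refine ⟨insert x S, ⟨Finset.insert_subset hxN hSN, fun i hi j hj hjS => ?_⟩, ?_⟩
    · have hj' : j ∉ S := fun h => hjS (Finset.mem_insert_of_mem h)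
      rcases Finset.mem_insert.1 hi with rfl | hi
      · exact hmax j (Finset.mem_sdiff.2 ⟨hj, hj'⟩)
      · exact htop i hi j hj hj'
    · rw [Finset.card_insert_of_notMem hxS, hS]

/-- A set of largest entries can be enlarged to one of any given size. -/
theorem IsTop.exists_superset {α : Type*} {a : α → ℝ} {N T : Finset α} (hT : IsTop a N T) {k : ℕ}
    (h1 : T.card ≤ k) (h2 : k ≤ N.card) : ∃ S, T ⊆ S ∧ IsTop a N S ∧ S.card = k := by
  classical
  have hcard := Finset.card_sdiff_of_subset hT.1
  obtain ⟨D, ⟨hDN, hD⟩, hDk⟩ := exists_isTop a (N \ T) (k := k - T.card) (by omega)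
  have hdisj : Disjoint T D :=
    Finset.disjoint_of_subset_right hDN Finset.disjoint_sdiff
  refine ⟨T ∪ D, Finset.subset_union_left,
    ⟨Finset.union_subset hT.1 (hDN.trans Finset.sdiff_subset), fun i hi j hj hjS => ?_⟩, ?_⟩
  · obtain ⟨hjT, hjD⟩ := not_or.1 (mt Finset.mem_union.2 hjS)
    rcases Finset.mem_union.1 hi with hi | hi
    · exact hT.2 i hi j hj hjT
    · exact hD i hi j (Finset.mem_sdiff.2 ⟨hj, hjT⟩) hjD
  · rw [Finset.card_union_of_disjoint hdisj, hDk]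
    omega

/-- The average over the largest entries is at least the average over all entries. -/
theorem IsTop.card_mul_sum_le {α : Type*} {a : α → ℝ} {N S : Finset α} (h : IsTop a N S) :
    S.card * ∑ i ∈ N, a i ≤ N.card * ∑ i ∈ S, a i := by
  classical
  -- Compare every entry inside `S` with every entry of `N` outside it, and sum over all pairs.
  have h1 : ∑ i ∈ S, ∑ j ∈ N \ S, a j ≤ ∑ i ∈ S, ∑ j ∈ N \ S, a i :=
    Finset.sum_le_sum fun i hi => Finset.sum_le_sum fun j hj =>
      h.2 i hi j (Finset.mem_sdiff.1 hj).1 (Finset.mem_sdiff.1 hj).2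
  simp only [Finset.sum_const, nsmul_eq_mul, ← Finset.mul_sum] at h1
  have h2 : ((N \ S).card : ℝ) + S.card = N.card := by
    exact_mod_cast Finset.card_sdiff_add_card_eq_card h.1
  rw [← Finset.sum_sdiff h.1, ← h2]
  linarith

/-! ### Chains with the same cardinalities -/

/-- The number of members of a chain that contain `i`. -/
noncomputable def chainDepth {n m : ℕ} (M : Fin m → Finset (Fin n)) (i : Fin n) : ℕ :=
  (Finset.univ.filter fun t => i ∈ M t).card

/-- In a decreasing chain the indices of the sets containing `i` form an initial segment, so its
length determines all memberships of `i`. -/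
theorem mem_iff_lt_chainDepth {n m : ℕ} {M : Fin m → Finset (Fin n)} (hM : Antitone M)
    (t : Fin m) (i : Fin n) : i ∈ M t ↔ (t : ℕ) < chainDepth M i := by
  constructor
  · intro h
    have hsub : Finset.Iic t ⊆ Finset.univ.filter fun s => i ∈ M s := fun s hs => by
      simpa using hM (Finset.mem_Iic.1 hs) h
    have := Finset.card_le_card hsub
    rw [Fin.card_Iic] at this
    exact this
  · intro h
    by_contra hn
    have hsub : (Finset.univ.filter fun s => i ∈ M s) ⊆ Finset.Iio t := fun s hs => by
      rw [Finset.mem_Iio]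
      by_contra! hts
      exact hn (hM hts (by simpa using hs))
    have := Finset.card_le_card hsub
    rw [Fin.card_Iio] at this
    exact absurd h (not_lt.2 this)

/-- Depth at least `c + 1` means membership in the set with index `c`, whose size is prescribed; the
bound `0` gives all nodes, and bounds beyond `m` give none. -/
theorem card_le_chainDepth_congr {n m : ℕ} {M N : Fin m → Finset (Fin n)} (hM : Antitone M)
    (hN : Antitone N) (hcard : ∀ t, (M t).card = (N t).card) (c : ℕ) :
    (Finset.univ.filter fun i => c ≤ chainDepth M i).card =
      (Finset.univ.filter fun i => c ≤ chainDepth N i).card := by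
  rcases c with _ | c
  · simp
  · by_cases hc : c < m
    · have key : ∀ {K : Fin m → Finset (Fin n)}, Antitone K →
          (Finset.univ.filter fun i => c + 1 ≤ chainDepth K i) = K ⟨c, hc⟩ := by
        intro K hK
        ext i
        simp [mem_iff_lt_chainDepth hK]
      rw [key hM, key hN, hcard]
    · have key : ∀ K : Fin m → Finset (Fin n),
          (Finset.univ.filter fun i => c + 1 ≤ chainDepth K i) = ∅ := by
        intro K
        ext i
        have : chainDepth K i ≤ m := (Finset.card_le_univ _).trans (by simp)
        simp
        omega
      rw [key M, key N]

/-- Two decreasing chains of sets with the same cardinalities differ by a permutation. -/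
theorem exists_perm_of_card_eq {n m : ℕ} {M N : Fin m → Finset (Fin n)} (hM : Antitone M)
    (hN : Antitone N) (hcard : ∀ t, (M t).card = (N t).card) :
    ∃ π : Equiv.Perm (Fin n), ∀ t i, π i ∈ N t ↔ i ∈ M t := by
  -- The nodes of depth exactly `c` are counted by a difference of two such cardinalities. Matching
  -- the nodes of each depth then yields the permutation.
  have hfib : ∀ c, Fintype.card {i // chainDepth M i = c} =
      Fintype.card {i // chainDepth N i = c} := by
    intro c
    have key : ∀ K : Fin m → Finset (Fin n), Fintype.card {i // chainDepth K i = c} +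
        (Finset.univ.filter fun i => c + 1 ≤ chainDepth K i).card =
          (Finset.univ.filter fun i => c ≤ chainDepth K i).card := by
      intro K
      rw [Fintype.card_subtype, ← Finset.card_union_of_disjoint]
      · congr 1
        ext i
        simp
        omega
      · rw [Finset.disjoint_filter]
        intro i _ h
        omega
    have h1 := key M
    have h2 := key N
    rw [card_le_chainDepth_congr hM hN hcard, card_le_chainDepth_congr hM hN hcard] at h1
    omega
  let e : ∀ c, {i // chainDepth M i = c} ≃ {i // chainDepth N i = c} :=
    fun c => Fintype.equivOfCardEq (hfib c)
  refine ⟨Equiv.ofFiberEquiv e, fun t i => ?_⟩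
  rw [mem_iff_lt_chainDepth hN, mem_iff_lt_chainDepth hM, Equiv.ofFiberEquiv_map e]

/-! ### Majorization and the optimum under permutations -/

theorem decreasing_comp_perm {n : ℕ} (x : Fin n → ℝ) (π : Equiv.Perm (Fin n)) :
    decreasing (x ∘ π) = decreasing x := by
  funext i
  exact congrFun (Tuple.comp_perm_comp_sort_eq_comp_sort (f := x) (σ := π)) i.rev

theorem OPT_spec {n m : ℕ} (E : Fin m → Request n) : IsMajorizationMinimal E (OPT E) :=
  (existsUnique_OPT E).choose_spec.1

/-- Reordering the arrivals, relabelling the offline nodes and enlarging the neighbourhoods does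
not make the optimum worse. -/
theorem majorizes_OPT {n m : ℕ} {E F : Fin m → Request n} (σ : Equiv.Perm (Fin m))
    (π : Equiv.Perm (Fin n)) (hqty : ∀ t, (F t).qty = (E (σ t)).qty)
    (hnbhd : ∀ t, ∀ i ∈ (E (σ t)).nbhd, π i ∈ (F t).nbhd) :
    Majorizes (OPT E) (OPT F) := by
  obtain ⟨x, hx, hsum⟩ := (OPT_spec E).1
  have hmem : OPT E ∘ π.symm ∈ feasibleLoads F := by
    refine ⟨fun t => x (σ t) ∘ π.symm, fun t => ⟨fun i => (hx (σ t)).1 _, fun i hi => ?_, ?_⟩, ?_⟩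
    · refine (hx (σ t)).2.1 _ fun h => hi ?_
      simpa using hnbhd t _ h
    · rw [hqty, ← (hx (σ t)).2.2]
      exact Equiv.sum_comp π.symm (x (σ t))
    · funext i
      rw [← hsum]
      simp only [Finset.sum_apply, Function.comp_apply]
      exact Equiv.sum_comp σ fun t => x t (π.symm i)
  have h := (OPT_spec F).2 _ hmem
  refine ⟨?_, fun j => ?_⟩
  · rw [← h.1]
    exact (Equiv.sum_comp π.symm (OPT E)).symm
  · rw [← decreasing_comp_perm (OPT E) π.symm]
    exact h.2 j

/-! ### The adversary -/

/-- An adversary that always moves on to the currently most loaded nodes. The allocations `X` are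
only assumed to be causal. -/
theorem exists_adversary {n m : ℕ} (X : (Fin m → Request n) → Fin m → Fin n → ℝ)
    (hX : ∀ F G t, (∀ s ≤ t, F s = G s) → X F t = X G t)
    (G : Fin m → Request n) (hG : Antitone fun t => (G t).nbhd.card) :
    ∃ F : Fin m → Request n, (∀ t, (F t).qty = (G t).qty) ∧
      (∀ t, (F t).nbhd.card = (G t).nbhd.card) ∧
      ∀ s t : Fin m, (s : ℕ) + 1 = t →
        IsTop (∑ r ∈ Finset.Iic s, X F r) (F s).nbhd (F t).nbhd := by
  -- Since `X` acts on full sequences, the sequence is corrected one position at a time, with the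
  -- entries of `G` as placeholders later on.
  suffices h : ∀ T : ℕ, ∃ F : Fin m → Request n, (∀ t, (F t).qty = (G t).qty) ∧
      (∀ t, (F t).nbhd.card = (G t).nbhd.card) ∧
      ∀ s t : Fin m, (s : ℕ) + 1 = t → (t : ℕ) < T →
        IsTop (∑ r ∈ Finset.Iic s, X F r) (F s).nbhd (F t).nbhd by
    obtain ⟨F, h1, h2, h3⟩ := h m
    exact ⟨F, h1, h2, fun s t hst => h3 s t hst t.2⟩
  intro T
  induction T with
  | zero => exact ⟨G, fun _ => rfl, fun _ => rfl, fun s t _ h => absurd h (Nat.not_lt_zero _)⟩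
  | succ T ih =>
    obtain ⟨F, hq, hc, htop⟩ := ih
    by_cases hT : T < m ∧ 0 < T
    swap
    · refine ⟨F, hq, hc, fun s t hst ht => htop s t hst ?_⟩
      have := t.2
      omega
    obtain ⟨hTm, hT0⟩ := hT
    let t₀ : Fin m := ⟨T, hTm⟩
    let s₀ : Fin m := ⟨T - 1, by omega⟩
    have hlt : s₀ < t₀ := Fin.lt_def.2 (by simp only [s₀, t₀]; omega)
    obtain ⟨S, hS, hScard⟩ := exists_isTop (∑ r ∈ Finset.Iic s₀, X F r) (F s₀).nbhd
      (k := (G t₀).nbhd.card) (by rw [hc]; exact hG hlt.le)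
    have hSne : S.Nonempty := by
      rw [← Finset.card_pos, hScard]
      exact (G t₀).nonempty.card_pos
    let F' : Fin m → Request n :=
      Function.update F t₀ ⟨S, hSne, (G t₀).qty, (G t₀).qty_pos⟩
    have hF' : ∀ t, t ≠ t₀ → F' t = F t := fun t ht => Function.update_of_ne ht _ _
    have hF'₀ : F' t₀ = ⟨S, hSne, (G t₀).qty, (G t₀).qty_pos⟩ := Function.update_self _ _ _
    -- Causality: changing the entry at `t₀` leaves the earlier loads alone, so the choices already
    -- made stay valid.
    have hload : ∀ s < t₀, ∑ r ∈ Finset.Iic s, X F' r = ∑ r ∈ Finset.Iic s, X F r := by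
      intro s hs
      refine Finset.sum_congr rfl fun r hr => hX _ _ _ fun r' hr' => hF' r' ?_
      exact (hr'.trans_lt ((Finset.mem_Iic.1 hr).trans_lt hs)).ne
    refine ⟨F', fun t => ?_, fun t => ?_, fun s t hst ht => ?_⟩
    · by_cases h : t = t₀
      · subst h; rw [hF'₀]
      · rw [hF' t h, hq]
    · by_cases h : t = t₀
      · subst h; rw [hF'₀]; exact hScard
      · rw [hF' t h, hc]
    · have hs : s < t₀ := Fin.lt_def.2 (by simp only [t₀]; omega)
      rw [hload s hs, hF' s hs.ne]
      by_cases h : t = t₀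
      · subst h
        have : s = s₀ := Fin.ext (by simp only [s₀, t₀] at hst ⊢; omega)
        subst this
        rw [hF'₀]
        exact hS
      · rw [hF' t h]
        refine htop s t hst ?_
        have : (t : ℕ) ≠ T := fun h' => h (Fin.ext h')
        omega

/-- If a decreasing chain of sets always passes on to the most loaded nodes, then some `j` nodes
have at least the total load that even splitting would give to the last `j` nodes. -/
theorem exists_sum_ge_share {n : ℕ} (N : ℕ → Finset (Fin n)) (x : ℕ → Fin n → ℝ) (q : ℕ → ℝ)
    (hN : N 0 = Finset.univ) {m : ℕ} (hpos : ∀ t ≤ m, (N t).Nonempty) (hend : N (m + 1) = ∅)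
    (hx : ∀ t ≤ m, ∀ i ∉ N t, x t i = 0)
    (hsum : ∀ t ≤ m, ∑ i, x t i = q t) (hq : ∀ t ≤ m, 0 ≤ q t)
    (htop : ∀ t ≤ m, IsTop (∑ s ∈ Finset.range (t + 1), x s) (N t) (N (t + 1)))
    {j : ℕ} (hj : j ≤ n) :
    ∃ S : Finset (Fin n), S.card = j ∧
      ∑ t ∈ Finset.range (m + 1), q t * share j (N t).card ≤
        ∑ i ∈ S, (∑ t ∈ Finset.range (m + 1), x t) i := by
  set a : ℕ → Fin n → ℝ := fun t => ∑ s ∈ Finset.range (t + 1), x s with ha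
  have hcard : ∀ t ≤ m, (0 : ℝ) < (N t).card := fun t ht => by exact_mod_cast (hpos t ht).card_pos
  have hfull : ∀ t ≤ m, ∀ S, N t ⊆ S → ∑ i ∈ S, x t i = q t := fun t ht S hS => by
    rw [← hsum t ht]
    exact Finset.sum_subset (Finset.subset_univ S) fun i _ hi => hx t ht i fun h => hi (hS h)
  -- The average load on `N t` is at least its value under even splitting: passing to a top set does
  -- not lower the average, and the new quantity falls entirely inside the new set.
  have havg : ∀ t ≤ m,
      (N t).card * ∑ s ∈ Finset.range (t + 1), q s / (N s).card ≤ ∑ i ∈ N t, a t i := by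
    intro t ht
    induction t with
    | zero =>
      have h0 := hfull 0 ht (N 0) subset_rfl
      have := hcard 0 ht
      simp only [ha, zero_add, Finset.sum_range_one, h0]
      rw [mul_div_cancel₀ _ this.ne']
    | succ t ih =>
      have h1 := ih (by omega)
      have h2 := (htop t (by omega)).card_mul_sum_le
      have h3 := hcard t (by omega)
      have h4 := hcard (t + 1) ht
      have h5 : ∑ i ∈ N (t + 1), a (t + 1) i = ∑ i ∈ N (t + 1), a t i + q (t + 1) := by
        rw [← hfull (t + 1) ht _ subset_rfl, ← Finset.sum_add_distrib]
        exact Finset.sum_congr rfl fun i _ => by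
          simp only [ha, Finset.sum_range_succ _ (t + 1), Pi.add_apply]
      rw [h5, Finset.sum_range_succ, mul_add, mul_div_cancel₀ _ h4.ne']
      refine add_le_add ?_ le_rfl
      refine le_of_mul_le_mul_left ?_ h3
      refine le_trans ?_ h2
      rw [mul_left_comm]
      exact mul_le_mul_of_nonneg_left h1 h4.le
  -- The moment when the chain shrinks past size `j`; it exists because the chain starts with all `n
  -- ≥ j` nodes and ends empty.
  obtain ⟨t, htm, htj, hjt⟩ : ∃ t ≤ m, j ≤ (N t).card ∧ (N (t + 1)).card ≤ j := by
    by_contra! hcon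
    have : ∀ t ≤ m + 1, j ≤ (N t).card := by
      intro t ht
      induction t with
      | zero => simpa [hN] using hj
      | succ t ih => exact (hcon t (by omega) (ih (by omega))).le
    have h1 := hcon m le_rfl (this m (by omega))
    simp [hend] at h1
  obtain ⟨S, hTS, hStop, hS⟩ := (htop t htm).exists_superset hjt htj
  refine ⟨S, hS, ?_⟩
  have hsplit : ∀ f : ℕ → ℝ, ∑ s ∈ Finset.range (m + 1), f s =
      ∑ s ∈ Finset.range (t + 1), f s + ∑ s ∈ Finset.Ico (t + 1) (m + 1), f s := fun f =>
    (Finset.sum_range_add_sum_Ico f (by omega)).symm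
  have hmono : ∀ s r, s ≤ r → r ≤ m → N r ⊆ N s := by
    intro s r hsr
    induction r, hsr using Nat.le_induction with
    | base => exact fun _ => subset_rfl
    | succ r _ ih => exact fun h => (htop r (by omega)).1.trans (ih (by omega))
  -- Up to time `t` the sets have at least `j` elements, so the shares are `j / |N s|`, and `S` has
  -- at least the average load of `N t`.
  have hearly : ∑ s ∈ Finset.range (t + 1), q s * share j (N s).card ≤ ∑ i ∈ S, a t i := by
    have h1 := hStop.card_mul_sum_le
    have h2 := havg t htm
    have h3 := hcard t htm
    rw [hS] at h1
    calc ∑ s ∈ Finset.range (t + 1), q s * share j (N s).card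
        ≤ ∑ s ∈ Finset.range (t + 1), j * (q s / (N s).card) := by
          refine Finset.sum_le_sum fun s hs => ?_
          have hs' : s ≤ t := by simpa [Nat.lt_succ_iff] using hs
          have := share_le_div (htj.trans (Finset.card_le_card (hmono s t hs' htm)))
            (hpos s (hs'.trans htm)).card_pos
          calc q s * share j (N s).card ≤ q s * (j / (N s).card) :=
                mul_le_mul_of_nonneg_left this (hq s (hs'.trans htm))
            _ = j * (q s / (N s).card) := by ring
      _ = j * ∑ s ∈ Finset.range (t + 1), q s / (N s).card := by rw [Finset.mul_sum]
      _ ≤ ∑ i ∈ S, a t i := by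
          refine le_of_mul_le_mul_left ?_ h3
          refine le_trans ?_ h1
          rw [mul_left_comm]
          exact mul_le_mul_of_nonneg_left h2 (Nat.cast_nonneg j)
  -- After time `t` each set lies in `N (t + 1)`, hence in `S`, which therefore collects the whole
  -- quantity.
  have hlate : ∑ s ∈ Finset.Ico (t + 1) (m + 1), q s * share j (N s).card ≤
      ∑ s ∈ Finset.Ico (t + 1) (m + 1), ∑ i ∈ S, x s i := by
    refine Finset.sum_le_sum fun s hs => ?_
    obtain ⟨h1, h2⟩ := Finset.mem_Ico.1 hs
    rw [hfull s (by omega) S ((hmono (t + 1) s h1 (by omega)).trans hTS)]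
    exact mul_le_of_le_one_right (hq s (by omega)) (share_le_one _ _)
  have hfin : ∑ i ∈ S, (∑ s ∈ Finset.range (m + 1), x s) i =
      ∑ i ∈ S, a t i + ∑ s ∈ Finset.Ico (t + 1) (m + 1), ∑ i ∈ S, x s i := by
    simp only [ha, Finset.sum_apply]
    rw [Finset.sum_comm, Finset.sum_comm (s := S) (t := Finset.range (t + 1)), hsplit]
  rw [hsplit, hfin]
  exact add_le_add hearly hlate

theorem sum_range_eq_sum_Iic {m : ℕ} {M : Type*} [AddCommMonoid M] (x : Fin m → M) (t : Fin m) :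
    ∑ s ∈ Finset.range (t + 1), (if h : s < m then x ⟨s, h⟩ else 0) =
      ∑ r ∈ Finset.Iic t, x r := by
  have h : Finset.range (t + 1) = (Finset.Iic t).map Fin.valEmbedding := by
    rw [Fin.map_valEmbedding_Iic]
    ext s
    simp
  rw [h, Finset.sum_map]
  exact Finset.sum_congr rfl fun r _ => by simp

/-- Against an adversary that always moves on to the currently most loaded nodes, some `j` nodes
get at least what even splitting would give to the last `j` nodes. -/
theorem exists_sum_ge_share_of_isTop {n m : ℕ} (hn : 0 < n) {F : Fin m → Request n}
    {x : Fin m → Fin n → ℝ} (hx : ∀ t, x t ∈ (F t).feasible)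
    (htop : ∀ s t : Fin m, (s : ℕ) + 1 = t →
      IsTop (∑ r ∈ Finset.Iic s, x r) (F s).nbhd (F t).nbhd)
    {j : ℕ} (hj : j ≤ n) :
    ∃ S : Finset (Fin n), S.card = j ∧
      ∑ t, (F t).qty * share j (F t).nbhd.card ≤ ∑ i ∈ S, (∑ t, x t) i := by
  -- All indices are shifted by one to make room for a dummy round `0` on the full node set with
  -- zero quantity. The chain then starts at `Finset.univ` even if the first neighbourhood is
  -- smaller.
  let N : ℕ → Finset (Fin n) := fun t =>
    Nat.casesOn t Finset.univ fun t => if h : t < m then (F ⟨t, h⟩).nbhd else ∅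
  let y : ℕ → Fin n → ℝ := fun t =>
    Nat.casesOn t 0 fun t => if h : t < m then x ⟨t, h⟩ else 0
  let p : ℕ → ℝ := fun t =>
    Nat.casesOn t 0 fun t => if h : t < m then (F ⟨t, h⟩).qty else 0
  have hNs : ∀ t : Fin m, N (t + 1) = (F t).nbhd := fun t => by simp [N]
  have hys : ∀ t : Fin m, y (t + 1) = x t := fun t => by simp [y]
  have hps : ∀ t : Fin m, p (t + 1) = (F t).qty := fun t => by simp [p]
  have hend : N (m + 1) = ∅ := by simp [N]
  have ofFin : ∀ {Q : ℕ → Prop}, Q 0 → (∀ t : Fin m, Q (t + 1)) → ∀ t ≤ m, Q t := by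
    intro Q h0 h1 t ht
    rcases t with _ | t
    · exact h0
    · exact h1 ⟨t, ht⟩
  obtain ⟨S, hS, hle⟩ := exists_sum_ge_share N y p rfl (m := m)
    (ofFin ⟨⟨0, hn⟩, Finset.mem_univ _⟩ fun t => by rw [hNs]; exact (F t).nonempty)
    hend
    (ofFin (fun i _ => rfl) fun t i hi => by
      rw [hys]; rw [hNs] at hi; exact (hx t).2.1 i hi)
    (ofFin (by simp [y, p]) fun t => by rw [hys, hps]; exact (hx t).2.2)
    (ofFin le_rfl fun t => by rw [hps]; exact (F t).qty_pos.le)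
    (ofFin ⟨Finset.subset_univ _, fun i _ k _ _ => by simp [y]⟩ fun t => by
      have hload : ∑ s ∈ Finset.range ((t : ℕ) + 1 + 1), y s = ∑ r ∈ Finset.Iic t, x r := by
        rw [Finset.sum_range_succ', ← sum_range_eq_sum_Iic x t]
        exact add_zero _
      rw [hload, hNs]
      by_cases ht : (t : ℕ) + 1 < m
      · have := htop t ⟨t + 1, ht⟩ rfl
        rwa [← hNs ⟨t + 1, ht⟩] at this
      · have : (t : ℕ) + 1 = m := by have := t.2; omega
        rw [this, hend]
        exact ⟨Finset.empty_subset _, by simp⟩)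
    hj
  refine ⟨S, hS, ?_⟩
  have h1 : ∑ t ∈ Finset.range (m + 1), p t * share j (N t).card =
      ∑ t, (F t).qty * share j (F t).nbhd.card := by
    rw [Finset.sum_range_succ', Finset.sum_range]
    simp only [hps, hNs]
    simp [p]
  have h2 : ∑ t ∈ Finset.range (m + 1), y t = ∑ t, x t := by
    rw [Finset.sum_range_succ', Finset.sum_range]
    simp only [hys]
    exact add_zero _
  rwa [h1, h2] at hle

/-! ### Expected allocations -/

/-- The coordinatewise expectation of the allocation of the online node `t`. -/
noncomputable def expectedAlloc {n m : ℕ} {Ω : Type*} [MeasurableSpace Ω] (P : Measure Ω)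
    (A : Ω → Policy n) (F : Fin m → Request n) (t : Fin m) : Fin n → ℝ :=
  fun i => ∫ ω, (A ω).alloc F t i ∂P

/-- Averaging over the coin flips preserves causality, the only property that `exists_adversary`
requires. -/
theorem expectedAlloc_congr {n m : ℕ} {Ω : Type*} [MeasurableSpace Ω] (P : Measure Ω)
    (A : Ω → Policy n) (F G : Fin m → Request n) (t : Fin m) (h : ∀ s ≤ t, F s = G s) :
    expectedAlloc P A F t = expectedAlloc P A G t := by
  funext i
  simp only [expectedAlloc, Policy.alloc_congr _ h]

theorem integrable_alloc {n m : ℕ} {Ω : Type*} [MeasurableSpace Ω] {P : Measure Ω}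
    [IsProbabilityMeasure P] {A : Ω → Policy n} {F : Fin m → Request n} {t : Fin m}
    (hA : AEMeasurable (fun ω => (A ω).alloc F t) P) (i : Fin n) :
    Integrable (fun ω => (A ω).alloc F t i) P := by
  refine Integrable.of_bound ((measurable_pi_apply i).comp_aemeasurable hA).aestronglyMeasurable
    (F t).qty (Filter.Eventually.of_forall fun ω => ?_)
  obtain ⟨h0, -, h2⟩ := (A ω).alloc_mem F t
  rw [Real.norm_of_nonneg (h0 i), ← h2]
  exact Finset.single_le_sum (fun j _ => h0 j) (Finset.mem_univ i)

/-- The feasibility constraints are linear equalities and inequalities, so they survive taking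
expectations. -/
theorem expectedAlloc_mem {n m : ℕ} {Ω : Type*} [MeasurableSpace Ω] {P : Measure Ω}
    [IsProbabilityMeasure P] {A : Ω → Policy n} {F : Fin m → Request n} {t : Fin m}
    (hA : AEMeasurable (fun ω => (A ω).alloc F t) P) :
    expectedAlloc P A F t ∈ (F t).feasible := by
  refine ⟨fun i => integral_nonneg fun ω => ((A ω).alloc_mem F t).1 i, fun i hi => ?_, ?_⟩
  · simp only [expectedAlloc, fun ω => ((A ω).alloc_mem F t).2.1 i hi, integral_zero]
  · simp only [expectedAlloc]
    rw [← integral_finsetSum _ fun i _ => integrable_alloc hA i]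
    simp [fun ω => ((A ω).alloc_mem F t).2.2]

theorem expectedRun_eq_sum {n m : ℕ} {Ω : Type*} [MeasurableSpace Ω] {P : Measure Ω}
    [IsProbabilityMeasure P] {A : Ω → Policy n} {F : Fin m → Request n}
    (hA : ∀ t, AEMeasurable (fun ω => (A ω).alloc F t) P) :
    expectedRun P A F = ∑ t, expectedAlloc P A F t := by
  funext i
  simp only [expectedRun, expectedAlloc, Policy.run, Finset.sum_apply]
  exact integral_finsetSum _ fun t _ => integrable_alloc (hA t) i

/-- Every randomized policy does at least as badly as even splitting on some relabelling of a
given nested sequence. -/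
theorem exists_nested_share_le {n m : ℕ} (hn : 0 < n) {Ω : Type*} [MeasurableSpace Ω]
    (P : Measure Ω) [IsProbabilityMeasure P] (A : Ω → Policy n) (G : Fin m → Request n)
    (hG : Antitone fun t => (G t).nbhd)
    (hA : ∀ F ∈ requestSeqs n m (∑ t, (G t).qty), ∀ t : Fin m,
      AEMeasurable (fun ω => (A ω).alloc F t) P) :
    ∃ F : Fin m → Request n, Antitone (fun t => (F t).nbhd) ∧ (∀ t, (F t).qty = (G t).qty) ∧
      (∃ π : Equiv.Perm (Fin n), ∀ t i, π i ∈ (F t).nbhd ↔ i ∈ (G t).nbhd) ∧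
      ∑ i, expectedRun P A F i = ∑ t, (G t).qty ∧
      ∀ j ≤ n, ∃ S : Finset (Fin n), S.card = j ∧
        ∑ t, (G t).qty * share j (G t).nbhd.card ≤ ∑ i ∈ S, expectedRun P A F i := by
  obtain ⟨F, hq, hc, htop⟩ := exists_adversary (expectedAlloc P A) (expectedAlloc_congr P A) G
    fun s t hst => Finset.card_le_card (hG hst)
  have hF : Antitone fun t => (F t).nbhd := by
    rcases m with _ | m
    · exact fun s => s.elim0
    · exact Fin.antitone_iff_succ_le.2 fun t => (htop t.castSucc t.succ (by simp)).1
  have hAF := hA F (by simp [requestSeqs, hq])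
  have hmem : ∀ t, expectedAlloc P A F t ∈ (F t).feasible := fun t => expectedAlloc_mem (hAF t)
  refine ⟨F, hF, hq, exists_perm_of_card_eq hG hF fun t => (hc t).symm, ?_, fun j hj => ?_⟩
  · rw [expectedRun_eq_sum hAF, sum_feasibleLoads ⟨_, hmem, rfl⟩]
    exact Finset.sum_congr rfl fun t _ => hq t
  · obtain ⟨S, hS, hle⟩ := exists_sum_ge_share_of_isTop hn hmem htop hj
    refine ⟨S, hS, ?_⟩
    rw [expectedRun_eq_sum hAF]
    simpa only [hq, hc] using hle

/-- The nested sequence associated with the run of water-filling on `E`: the arrivals are sorted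
by water level, and every neighbourhood is enlarged to the nodes whose final load is at least the
water level. -/
noncomputable def nestedHull {n m : ℕ} (E : Fin m → Request n) (t : Fin m) : Request n where
  nbhd := superlevel ((WF n).run E) (waterLevel E (Tuple.sort (waterLevel E) t))
  nonempty := (E (Tuple.sort (waterLevel E) t)).nonempty.mono fun i hi =>
    mem_superlevel.2 (waterLevel_le_run E _ i hi)
  qty := (E (Tuple.sort (waterLevel E) t)).qty
  qty_pos := (E (Tuple.sort (waterLevel E) t)).qty_pos

theorem antitone_nbhd_nestedHull {n m : ℕ} (E : Fin m → Request n) :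
    Antitone fun t => (nestedHull E t).nbhd := fun _ _ hst =>
  superlevel_anti _ (Tuple.monotone_sort (waterLevel E) hst)

end OnlineAlloc

theorem theorem1 (n m : ℕ) (q : ℝ) (hq : 0 < q)
    {Ω : Type*} [MeasurableSpace Ω] (P : Measure Ω)
    [IsProbabilityMeasure P]
    (A : Ω → Policy n)
    (hA : ∀ F ∈ requestSeqs n m q, ∀ t : Fin m, AEMeasurable (fun ω => (A ω).alloc F t) P)
    (E : Fin m → Request n) (hE : E ∈ requestSeqs n m q) :
    ∃ E' ∈ nestedSeqs n m q,
      Majorizes (expectedRun P A E') ((WF n).run E) ∧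
        Majorizes (OPT E) (OPT E') := by
  have hE' : ∑ t, (E t).qty = q := hE
  have hsumG : ∑ t, (nestedHull E t).qty = q := by
    rw [← hE']
    exact Equiv.sum_comp (Tuple.sort (waterLevel E)) fun t => (E t).qty
  -- A positive total quantity forces an arrival, and an arrival has a neighbour.
  have hn : 0 < n := by
    rcases m with _ | m
    · simp only [Finset.univ_eq_empty, Finset.sum_empty] at hE'
      exact absurd hE' hq.ne
    · obtain ⟨i, -⟩ := (E 0).nonempty
      exact i.pos
  obtain ⟨F, hF, hqty, ⟨π, hπ⟩, hsum, hshare⟩ :=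
    exists_nested_share_le hn P A (nestedHull E) (antitone_nbhd_nestedHull E) (by rwa [hsumG])
  refine ⟨F, ⟨?_, fun s t hst => hF hst⟩, ⟨?_, fun j => ?_⟩, ?_⟩
  · simpa only [requestSeqs, Set.mem_ofPred_eq, hqty] using hsumG
  · rw [hsum, hsumG, Policy.sum_run, hE']
  · obtain ⟨S, hS, hle⟩ := hshare (Finset.Iic j).card (by rw [Fin.card_Iic]; exact j.2)
    calc ∑ i ∈ Finset.Iic j, decreasing ((WF n).run E) i
        = ∑ i ∈ topSet ((WF n).run E) j, (WF n).run E i := (sum_topSet _ _ j).symm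
      _ ≤ ∑ t, (E t).qty * share (Finset.Iic j).card
            (superlevel ((WF n).run E) (waterLevel E t)).card := by
          rw [← card_topSet ((WF n).run E) j]
          exact sum_run_WF_le E _
      _ = ∑ t, (nestedHull E t).qty * share (Finset.Iic j).card (nestedHull E t).nbhd.card :=
          (Equiv.sum_comp (Tuple.sort (waterLevel E)) fun t => (E t).qty *
            share (Finset.Iic j).card (superlevel ((WF n).run E) (waterLevel E t)).card).symm
      _ ≤ ∑ i ∈ S, expectedRun P A F i := hle
      _ ≤ ∑ i ∈ Finset.Iic j, decreasing (expectedRun P A F) i :=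
          sum_le_sum_decreasing _ j S hS
  -- The sorting permutation reorders the arrivals, `π` relabels the nodes, and `waterLevel_le_run`
  -- shows that neighbourhoods only grow.
  · refine majorizes_OPT (Tuple.sort (waterLevel E)) π hqty fun t i hi => (hπ t i).2 ?_
    exact mem_superlevel.2 (waterLevel_le_run E _ i hi)
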